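/- Lemma 2.4. For functions on $\mathbf{R}_x\times\mathbf{R}_t$ let $\widehat u(\xi,\tau)=\frac1{2\pi}\iint e^{-i(x\xi+t\tau)}u(x,t)\,dx\,dt$ be the space-time Fourier transform (extended to $L^2$ by Plancherel), let $\widehat{D_x^{1/2}u}(\xi,\tau)=|\xi|^{1/2}\widehat u(\xi,\tau)$, and let $\langle\lambda\rangle=(1+\lambda^2)^{1/2}$. For $m,b\ge 0$ let $X^{m,b}$ and $X_\pm^{m,b}$ be the spaces of complex-valued $f\in L^2(\mathbf{R}^2)$ with finite norm $$\|f\|_{X^{m,b}}=\|\langle\xi\rangle^m\langle\tau+|\xi|^2\rangle^b\widehat f(\xi,\tau)\|_{L^2_{\xi\tau}},\qquad \|f\|_{X_\pm^{m,b}}=\|\langle\xi\rangle^m\langle\tau\pm|\xi|\rangle^b\widehat f(\xi,\tau)\|_{L^2_{\xi\tau}}$$ (the completions of the Schwartz space in these norms). For every $s>0$ there is $p_0<2$ such that for every $p\in(p_0,2)$ and every $b>\frac12$ there is a constant $c=c(s,p,b)$ with the following property. For either choice of the sign $\pm$, all $u\in X^{s,1/2}$ and all $n_\pm\in X_\pm^{0,b}$,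 the convolution $\widehat{D_x^{1/2}u}*\widehat n_\pm$ (in the variables $(\xi,\tau)\in\mathbf{R}^2$) converges absolutely almost everywhere, and $$\big\|\widehat{D_x^{1/2}u}*\widehat n_\pm\big\|_{L^2_\xi L^p_\tau}\le c\,\|n_\pm\|_{X_\pm^{0,b}}\,\|u\|_{X^{s,1/2}},$$ where $\|h\|_{L^2_\xi L^p_\tau}=\big\|\,\|h(\xi,\tau)\|_{L^p_\tau}\big\|_{L^2_\xi}$. -/

import Mathlib

open MeasureTheory

noncomputable section

namespace Zakharov

/-- Space-time `ℝ_x × ℝ_t`, with its Euclidean structure: coordinate `0` is `x`, coordinate `1`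
is `t`. -/
abbrev SpaceTime : Type := EuclideanSpace ℝ (Fin 2)

/-- Complex-valued `L²` functions of space-time. -/
abbrev L2SpaceTime : Type := Lp (α := SpaceTime) ℂ 2 volume

/-- The Japanese bracket `⟨x⟩ = (1 + x²)^{1/2}`. -/
def bracket (x : ℝ) : ℝ := Real.sqrt (1 + x ^ 2)

/-- The unitary space-time Fourier transform
`û(ξ, τ) = (2π)⁻¹ ∫∫ e^{-i(xξ + tτ)} u(x, t) dx dt`, extended to `L²` by Plancherel.
Mathlib's transform has the kernel `e^{-2πi⟨v, w⟩}`, whence the rescaling of the frequencies. -/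
def hat (u : L2SpaceTime) (p : ℝ × ℝ) : ℂ :=
  ((2 * Real.pi)⁻¹ : ℝ) •
    (FourierTransform.fourier u : L2SpaceTime)
      (!₂[p.1 / (2 * Real.pi), p.2 / (2 * Real.pi)] : SpaceTime)

/-- The Bourgain norm
`‖u‖_{X_φ^{m,b}} = ‖⟨ξ⟩^m ⟨τ + φ(ξ)⟩^b û(ξ, τ)‖_{L²_{ξτ}}`, with values in `[0, ∞]`. -/
def xNorm (φ : ℝ → ℝ) (m b : ℝ) (u : L2SpaceTime) : ENNReal :=
  eLpNorm (fun p : ℝ × ℝ => (bracket p.1 ^ m * bracket (p.2 + φ p.1) ^ b) • hat u p) 2 volume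

/-- Membership in `X_φ^{m,b}` for `m, b ≥ 0`. As the weight is then at least `1`, the completion of
the Schwartz space in the norm `xNorm φ m b` is the space of the `L²` functions for which this norm
is finite (for `φ` continuous and of polynomial growth, as are the two symbols below). -/
def MemX (φ : ℝ → ℝ) (m b : ℝ) (u : L2SpaceTime) : Prop :=
  xNorm φ m b u < ⊤

/-- The Schrödinger symbol `φ(ξ) = |ξ|²`: it gives the spaces `X^{m,b}`. -/
def schrodingerSymbol (ξ : ℝ) : ℝ := |ξ| ^ 2

/-- The half-wave symbols `φ(ξ) = ±|ξ|` (`σ = ±1`): they give the spaces `X_±^{m,b}`. -/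
def waveSymbol (σ : ℝ) (ξ : ℝ) : ℝ := σ * |ξ|

/-- The Fourier transform of `D_x^{1/2} u`, that is `|ξ|^{1/2} û(ξ, τ)`. -/
def hatDHalf (u : L2SpaceTime) (p : ℝ × ℝ) : ℂ :=
  (|p.1| ^ (1 / 2 : ℝ)) • hat u p

/-- The mixed norm `‖h‖_{L²_ξ L^p_τ}`, with values in `[0, ∞]`. -/
def mixedNorm (p : ℝ) (h : ℝ × ℝ → ℂ) : ENNReal :=
  eLpNorm (fun ξ : ℝ => eLpNorm (fun τ : ℝ => h (ξ, τ)) (ENNReal.ofReal p) volume) 2 volume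

end Zakharov

end

/-!
Write `|û| = ⟨ξ⟩^{-s} ⟨τ + ξ²⟩^{-1/2} F` and `|n̂| = ⟨τ + σ|ξ|⟩^{-b} G` with `F, G ∈ L²`. By
Cauchy–Schwarz the convolution of `|ξ|^{1/2} |û|` and `|n̂|` is at most `K^{1/2} (F² * G²)^{1/2}`, where
`K(ξ, τ) = ∫∫ |x| ⟨x⟩^{-2s} ⟨t + x²⟩^{-1} ⟨τ - t + σ|ξ - x|⟩^{-2b} dx dt`.
Since `F² * G²` is in `L¹`, Hölder's inequality in `τ` reduces the estimate to a bound for `K` in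
`L^Q_τ` that is uniform in `ξ`, with `Q = p / (2 - p)` (`lintegral_weighted_convolution_le`).

As `p` tends to `2` the exponent `Q` tends to `∞`, so that `Q > 1` and `sQ > 1` for `p` near `2`. Then
the integrand of `K` is `A^{1/Q} B^{1-1/Q}`, where `A` carries `⟨x⟩^{-1-sQ}` and a power of
`⟨t + x²⟩` below `-1`, and `B` carries `⟨x⟩^{-η}`, `η > 0`, and a power of `⟨t + x²⟩` slightly above
`-1`. The integral of `A` in `(x, t, τ)` is a product of convergent integrals
(`lintegral_lintegral_kern`). In `B` the small power of `⟨x⟩` makes up for the missing decay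
(`decay_mul_decay_le`), and what remains is bounded because the change of variables
`x ↦ x² + σ|ξ - x|` absorbs the factor `|x|` (`lintegral_absE_mul_decay_resonance_le`). Together
these give `exists_lintegral_kern_rpow_le`.

Absolute convergence almost everywhere follows, all the bounds being for the integral of the
absolute value.
-/

/-! ### Decaying powers of the Japanese bracket -/

namespace Zakharov

open Set
open scoped ENNReal

theorem one_le_bracket (x : ℝ) : 1 ≤ bracket x := by
  unfold bracket
  exact Real.one_le_sqrt.2 (by nlinarith [sq_nonneg x])

theorem bracket_pos (x : ℝ) : 0 < bracket x := zero_lt_one.trans_le (one_le_bracket x)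

theorem abs_le_bracket (x : ℝ) : |x| ≤ bracket x :=
  Real.abs_le_sqrt (by linarith)

@[fun_prop]
theorem measurable_bracket : Measurable bracket := by
  unfold bracket
  fun_prop

/-- The weight `⟨x⟩^{-r}`, with values in `[0, ∞]`. -/
noncomputable def decay (r x : ℝ) : ℝ≥0∞ := ENNReal.ofReal (bracket x ^ (-r))

/-- The absolute value `|x|`, with values in `[0, ∞]`. -/
noncomputable def absE (x : ℝ) : ℝ≥0∞ := ENNReal.ofReal |x|

@[fun_prop]
theorem measurable_decay (r : ℝ) : Measurable (decay r) := by
  unfold decay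
  fun_prop

@[fun_prop]
theorem measurable_absE : Measurable absE := by
  unfold absE
  fun_prop

theorem decay_add (r r' x : ℝ) : decay (r + r') x = decay r x * decay r' x := by
  rw [decay, decay, decay, ← ENNReal.ofReal_mul (Real.rpow_nonneg (bracket_pos x).le _),
    ← Real.rpow_add (bracket_pos x), neg_add]

theorem decay_rpow (r q x : ℝ) : decay r x ^ q = decay (r * q) x := by
  rw [decay, decay, ENNReal.ofReal_rpow_of_pos (Real.rpow_pos_of_pos (bracket_pos x) _),
    ← Real.rpow_mul (bracket_pos x).le, neg_mul]

theorem decay_le_decay {r r' : ℝ} (h : r' ≤ r) (x : ℝ) : decay r x ≤ decay r' x :=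
  ENNReal.ofReal_le_ofReal (Real.rpow_le_rpow_of_exponent_le (one_le_bracket x) (by linarith))

theorem decay_le_one {r : ℝ} (h : 0 ≤ r) (x : ℝ) : decay r x ≤ 1 :=
  (decay_le_decay h x).trans (by simp [decay])

theorem lintegral_decay_lt_top {r : ℝ} (hr : 1 < r) : ∫⁻ x, decay r x < ∞ := by
  have h := integrable_rpow_neg_one_add_norm_sq (E := ℝ) (μ := volume) (r := r) (by simpa using hr)
  refine lt_of_eq_of_lt (lintegral_congr fun x => ?_) h.lintegral_lt_top
  rw [decay, bracket, Real.sqrt_eq_rpow, ← Real.rpow_mul (by positivity), Real.norm_eq_abs, sq_abs]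
  ring_nf

theorem lintegral_absE_mul_decay_lt_top {r : ℝ} (hr : 2 < r) :
    ∫⁻ x, absE x * decay r x < ∞ := by
  refine lt_of_le_of_lt (lintegral_mono fun x => ?_)
    (lintegral_decay_lt_top (r := r - 1) (by linarith))
  have h : absE x ≤ decay (-1) x := by
    unfold absE decay
    exact ENNReal.ofReal_le_ofReal (by simpa using abs_le_bracket x)
  calc absE x * decay r x ≤ decay (-1) x * decay r x := by gcongr
    _ = decay (r - 1) x := by rw [← decay_add]; congr 1; ring

/-- The decay of either variable can be traded for the other: if `⟨y⟩ ≤ ⟨x⟩²` some decay in `x` is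
turned into decay in `y`, and otherwise the decay in `y` gives almost two powers of `⟨x⟩`. -/
theorem decay_mul_decay_le {e η : ℝ} (he : 0 < e) (he1 : e ≤ 1) (hη : 4 * e ≤ η) (x y : ℝ) :
    decay η x * decay (1 - e) y ≤ decay (2 + e) x + decay (1 + e) y := by
  rcases le_total (bracket y) (bracket x ^ (2 : ℝ)) with h | h
  · refine le_add_left ?_
    have h1 : decay η x ≤ decay (2 * e) y := by
      refine (decay_le_decay hη x).trans (ENNReal.ofReal_le_ofReal ?_)
      calc bracket x ^ (-(4 * e)) = (bracket x ^ (2 : ℝ)) ^ (-(2 * e)) := by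
            rw [← Real.rpow_mul (bracket_pos x).le]; ring_nf
        _ ≤ bracket y ^ (-(2 * e)) :=
            Real.rpow_le_rpow_of_nonpos (bracket_pos y) h (by linarith)
    calc decay η x * decay (1 - e) y ≤ decay (2 * e) y * decay (1 - e) y := by gcongr
      _ = decay (1 + e) y := by rw [← decay_add]; congr 1; ring
  · refine le_add_right ?_
    have h1 : decay (1 - e) y ≤ decay (2 * (1 - e)) x := by
      refine ENNReal.ofReal_le_ofReal ?_
      calc bracket y ^ (-(1 - e)) ≤ (bracket x ^ (2 : ℝ)) ^ (-(1 - e)) :=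
            Real.rpow_le_rpow_of_nonpos (Real.rpow_pos_of_pos (bracket_pos x) _) h (by linarith)
        _ = bracket x ^ (-(2 * (1 - e))) := by
            rw [← Real.rpow_mul (bracket_pos x).le]; ring_nf
    calc decay η x * decay (1 - e) y ≤ decay η x * decay (2 * (1 - e)) x := by gcongr
      _ = decay (η + 2 * (1 - e)) x := by rw [← decay_add]
      _ ≤ decay (2 + e) x := decay_le_decay (by linarith) x

/-! ### The parabolic change of variables -/

theorem setLIntegral_absE_mul_comp_sq_le (g : ℝ → ℝ≥0∞) {s : Set ℝ} (hs : MeasurableSet s)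
    (hinj : InjOn (fun x : ℝ => x ^ 2) s) :
    ∫⁻ x in s, absE x * g (x ^ 2) ≤ ∫⁻ y, g y := by
  have h := lintegral_image_eq_lintegral_abs_deriv_mul (f := fun x : ℝ => x ^ 2)
    (f' := fun x => 2 * x) hs
    (fun x _ => by simpa using (hasDerivAt_pow 2 x).hasDerivWithinAt) hinj g
  calc ∫⁻ x in s, absE x * g (x ^ 2)
      ≤ ∫⁻ x in s, ENNReal.ofReal |2 * x| * g (x ^ 2) := by
        refine lintegral_mono fun x => ?_
        gcongr
        refine ENNReal.ofReal_le_ofReal ?_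
        rw [abs_mul, abs_two]
        linarith [abs_nonneg x]
    _ = ∫⁻ y in (fun x : ℝ => x ^ 2) '' s, g y := h.symm
    _ ≤ ∫⁻ y, g y := setLIntegral_le_lintegral _ _

theorem lintegral_absE_mul_comp_sq_le (g : ℝ → ℝ≥0∞) :
    ∫⁻ x, absE x * g (x ^ 2) ≤ 2 * ∫⁻ y, g y := by
  rw [← lintegral_add_compl _ (measurableSet_Ici (a := (0 : ℝ))), two_mul, compl_Ici]
  refine add_le_add (setLIntegral_absE_mul_comp_sq_le g measurableSet_Ici ?_)
    (setLIntegral_absE_mul_comp_sq_le g measurableSet_Iio ?_)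
  · intro x hx y hy h
    exact (sq_eq_sq₀ hx hy).1 h
  · intro x hx y hy h
    simp only [mem_Iio] at hx hy
    dsimp only at h
    nlinarith

theorem lintegral_absE_mul_decay_quadratic_le (r a κ : ℝ) :
    ∫⁻ x, absE (x - κ / 2) * decay r (a + x ^ 2 - κ * x) ≤ 2 * ∫⁻ y, decay r y := by
  calc ∫⁻ x, absE (x - κ / 2) * decay r (a + x ^ 2 - κ * x)
      = ∫⁻ x, absE (x - κ / 2) * decay r ((x - κ / 2) ^ 2 + (a - κ ^ 2 / 4)) :=
        lintegral_congr fun x => by congr 2; ring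
    _ = ∫⁻ x, absE x * decay r (x ^ 2 + (a - κ ^ 2 / 4)) :=
        lintegral_sub_right_eq_self (fun x => absE x * decay r (x ^ 2 + (a - κ ^ 2 / 4))) (κ / 2)
    _ ≤ 2 * ∫⁻ y, decay r (y + (a - κ ^ 2 / 4)) :=
        lintegral_absE_mul_comp_sq_le fun y => decay r (y + (a - κ ^ 2 / 4))
    _ = 2 * ∫⁻ y, decay r y := by rw [lintegral_add_right_eq_self (decay r)]

/-- Uniform integrability along the resonance function `x² + σ|ξ - x|`: on `|x| ≥ 1` its derivative
dominates `|x|`, on either side of `x = ξ`. -/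
theorem lintegral_absE_mul_decay_resonance_le {r σ : ℝ} (hr : 0 ≤ r) (hσ : σ = 1 ∨ σ = -1)
    (a ξ : ℝ) :
    ∫⁻ x, absE x * decay r (a + x ^ 2 + σ * |ξ - x|) ≤ 2 + 8 * ∫⁻ y, decay r y := by
  have key : ∀ x, absE x * decay r (a + x ^ 2 + σ * |ξ - x|) ≤
      (Icc (-1 : ℝ) 1).indicator 1 x +
        (2 * (absE (x - 1 / 2) * decay r ((a + ξ) + x ^ 2 - 1 * x)) +
          2 * (absE (x - (-1) / 2) * decay r ((a - ξ) + x ^ 2 - (-1) * x))) := by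
    intro x
    by_cases hx : x ∈ Icc (-1 : ℝ) 1
    · refine le_add_right ?_
      rw [indicator_of_mem hx]
      refine mul_le_one' ?_ (decay_le_one hr _)
      rw [absE, ENNReal.ofReal_le_one, abs_le]
      exact hx
    · refine le_add_left ?_
      have hx1 : 1 < |x| := by
        by_contra! h
        exact hx (abs_le.1 h)
      have hab : ∀ κ : ℝ, |κ| = 1 → absE x ≤ 2 * absE (x - κ / 2) := by
        intro κ hκ
        rw [absE, absE, ← ENNReal.ofReal_ofNat 2, ← ENNReal.ofReal_mul zero_le_two]
        refine ENNReal.ofReal_le_ofReal ?_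
        have := abs_sub_abs_le_abs_sub x (κ / 2)
        rw [abs_div, hκ, abs_two] at this
        linarith
      have hcase : σ * |ξ - x| = ξ - x ∨ σ * |ξ - x| = -ξ + x := by
        rcases hσ with rfl | rfl <;> rcases abs_choice (ξ - x) with h | h <;> rw [h]
        · left; ring
        · right; ring
        · right; ring
        · left; ring
      rcases hcase with h | h <;> rw [h]
      · refine le_add_right ?_
        rw [← mul_assoc, show a + x ^ 2 + (ξ - x) = (a + ξ) + x ^ 2 - 1 * x by ring]
        gcongr
        exact hab 1 (by simp)
      · refine le_add_left ?_
        rw [← mul_assoc, show a + x ^ 2 + (-ξ + x) = (a - ξ) + x ^ 2 - (-1) * x by ring]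
        gcongr
        exact hab (-1) (by simp)
  calc ∫⁻ x, absE x * decay r (a + x ^ 2 + σ * |ξ - x|)
      ≤ _ := lintegral_mono key
    _ = (∫⁻ x, (Icc (-1 : ℝ) 1).indicator 1 x) +
        (2 * (∫⁻ x, absE (x - 1 / 2) * decay r ((a + ξ) + x ^ 2 - 1 * x)) +
          2 * ∫⁻ x, absE (x - (-1) / 2) * decay r ((a - ξ) + x ^ 2 - (-1) * x)) := by
        rw [lintegral_add_left (measurable_one.indicator measurableSet_Icc),
          lintegral_add_left (by fun_prop), lintegral_const_mul _ (by fun_prop),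
          lintegral_const_mul _ (by fun_prop)]
    _ ≤ 2 + (2 * (2 * ∫⁻ y, decay r y) + 2 * (2 * ∫⁻ y, decay r y)) := by
        gcongr
        · rw [lintegral_indicator_one measurableSet_Icc, Real.volume_Icc]
          norm_num
        · exact lintegral_absE_mul_decay_quadratic_le r _ 1
        · exact lintegral_absE_mul_decay_quadratic_le r _ (-1)
    _ = 2 + 8 * ∫⁻ y, decay r y := by ring

/-! ### The kernel of the Cauchy–Schwarz inequality -/

/-- The kernel `|x| ⟨x⟩^{-α} ⟨t + x²⟩^{-β} ⟨τ - t + σ|ξ - x|⟩^{-r}`, with `z = (ξ, τ)` and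
`y = (x, t)`: the weight that the two Bourgain norms leave in the convolution, squared. -/
noncomputable def kern (α β r σ : ℝ) (z y : ℝ × ℝ) : ℝ≥0∞ :=
  absE y.1 * decay α y.1 * decay β (y.2 + y.1 ^ 2) * decay r (z.2 - y.2 + σ * |z.1 - y.1|)

theorem measurable_kern (α β r σ : ℝ) :
    Measurable fun q : (ℝ × ℝ) × (ℝ × ℝ) => kern α β r σ q.1 q.2 := by
  unfold kern
  fun_prop

@[fun_prop]
theorem measurable_kern_right (α β r σ : ℝ) (z : ℝ × ℝ) : Measurable (kern α β r σ z) := by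
  unfold kern
  fun_prop

theorem kern_rpow_mul_kern_rpow {t : ℝ} (ht : 0 ≤ t) (ht1 : t ≤ 1) (α₁ α₂ β₁ β₂ r σ : ℝ)
    (z y : ℝ × ℝ) :
    kern α₁ β₁ r σ z y ^ t * kern α₂ β₂ r σ z y ^ (1 - t) =
      kern (α₁ * t + α₂ * (1 - t)) (β₁ * t + β₂ * (1 - t)) r σ z y := by
  have ht' : 0 ≤ 1 - t := by linarith
  have hr : ∀ x : ℝ≥0∞, x = x ^ t * x ^ (1 - t) := fun x => by
    rw [← ENNReal.rpow_add_of_nonneg _ _ ht ht']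
    simp
  have hr' : ∀ x : ℝ, decay r x = decay (r * t) x * decay (r * (1 - t)) x := fun x => by
    rw [← decay_add]
    congr 1
    ring
  unfold kern
  simp only [ENNReal.mul_rpow_of_nonneg _ _ ht, ENNReal.mul_rpow_of_nonneg _ _ ht', decay_rpow,
    decay_add]
  rw [hr' (z.2 - y.2 + σ * |z.1 - y.1|)]
  nth_rewrite 3 [hr (absE y.1)]
  ring

theorem lintegral_lintegral_kern (α β r σ ξ : ℝ) :
    ∫⁻ τ, ∫⁻ y, kern α β r σ (ξ, τ) y =
      (∫⁻ x, absE x * decay α x) * (∫⁻ x, decay β x) * ∫⁻ x, decay r x := by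
  have hm : Measurable fun q : ℝ × (ℝ × ℝ) => kern α β r σ (ξ, q.1) q.2 := by
    unfold kern
    fun_prop
  rw [lintegral_lintegral_swap hm.aemeasurable]
  have h1 : ∀ y : ℝ × ℝ, ∫⁻ τ, kern α β r σ (ξ, τ) y =
      absE y.1 * decay α y.1 * decay β (y.2 + y.1 ^ 2) * ∫⁻ x, decay r x := fun y => by
    simp only [kern]
    rw [lintegral_const_mul _ (by fun_prop)]
    congr 1
    simp only [sub_add_eq_add_sub, add_sub_assoc]
    exact lintegral_add_right_eq_self (decay r) (σ * |ξ - y.1| - y.2)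
  simp only [h1]
  rw [lintegral_mul_const _ (by fun_prop), Measure.volume_eq_prod,
    lintegral_prod _ (by fun_prop)]
  congr 1
  rw [← lintegral_mul_const _ (by fun_prop)]
  refine lintegral_congr fun x => ?_
  dsimp only
  rw [lintegral_const_mul _ (by fun_prop)]
  congr 1
  exact lintegral_add_right_eq_self (decay β) (x ^ 2)

theorem lintegral_kern_le {e η : ℝ} (he : 0 < e) (he1 : e ≤ 1) (hη : 4 * e ≤ η) (r : ℝ) {σ : ℝ}
    (hσ : σ = 1 ∨ σ = -1) (z : ℝ × ℝ) :
    ∫⁻ y, kern η (1 - e) r σ z y ≤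
      (∫⁻ x, absE x * decay (2 + e) x) * (∫⁻ x, decay r x) +
        (2 + 8 * ∫⁻ x, decay (1 + e) x) * ∫⁻ x, decay r x := by
  obtain ⟨ξ, τ⟩ := z
  have hpt : ∀ y : ℝ × ℝ, kern η (1 - e) r σ (ξ, τ) y ≤
      absE y.1 * decay (2 + e) y.1 * decay r (τ - y.2 + σ * |ξ - y.1|) +
        absE y.1 * decay (1 + e) (y.2 + y.1 ^ 2) * decay r (τ - y.2 + σ * |ξ - y.1|) := fun y => by
    rw [kern, ← add_mul, ← mul_add, mul_assoc (absE y.1)]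
    gcongr
    exact decay_mul_decay_le he he1 hη _ _
  refine (lintegral_mono hpt).trans ?_
  rw [lintegral_add_left (by fun_prop)]
  refine add_le_add (le_of_eq ?_) ?_
  · rw [Measure.volume_eq_prod, lintegral_prod _ (by fun_prop),
      ← lintegral_mul_const _ (by fun_prop)]
    refine lintegral_congr fun x => ?_
    dsimp only
    rw [lintegral_const_mul _ (by fun_prop)]
    congr 1
    rw [← lintegral_sub_left_eq_self (decay r) (τ + σ * |ξ - x|)]
    exact lintegral_congr fun t => by congr 1; ring
  · -- The wave variable `l = τ - t + σ|ξ - x|` replaces `t`, for fixed `x`.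
    have h2 : ∀ x : ℝ, ∫⁻ t, absE x * decay (1 + e) (t + x ^ 2) * decay r (τ - t + σ * |ξ - x|) =
        ∫⁻ l, absE x * decay (1 + e) (τ - l + x ^ 2 + σ * |ξ - x|) * decay r l := fun x => by
      rw [← lintegral_sub_left_eq_self _ (τ + σ * |ξ - x|)]
      refine lintegral_congr fun l => ?_
      congr 3 <;> ring
    rw [Measure.volume_eq_prod, lintegral_prod _ (by fun_prop)]
    simp only [h2]
    rw [lintegral_lintegral_swap (by fun_prop), ← lintegral_const_mul _ (by fun_prop)]
    refine lintegral_mono fun l => ?_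
    rw [lintegral_mul_const _ (by fun_prop)]
    gcongr
    exact lintegral_absE_mul_decay_resonance_le (by linarith) hσ _ _

/-- The kernel is in `L^Q_τ`, uniformly in `ξ`. By Hölder's inequality with the exponents `Q` and
`Q / (Q - 1)` it splits into one factor that is integrable in all of `(x, t, τ)`, and one whose
integral in `(x, t)` is bounded. -/
theorem exists_lintegral_kern_rpow_le {s b Q : ℝ} (hQ : 1 < Q) (hsQ : 1 < s * Q) (hb : 1 / 2 < b) :
    ∃ C : ℝ≥0∞, C < ∞ ∧ ∀ σ : ℝ, σ = 1 ∨ σ = -1 → ∀ ξ : ℝ,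
      ∫⁻ τ, (∫⁻ y, kern (2 * s) 1 (2 * b) σ (ξ, τ) y) ^ Q ≤ C := by
  have hQ0 : 0 < Q := by linarith
  have hQ1 : 0 < Q - 1 := by linarith
  set η : ℝ := (s * Q - 1) / (Q - 1) with hη
  have hη0 : 0 < η := div_pos (by linarith) hQ1
  set e : ℝ := min 1 (η / 4) with he
  have he0 : 0 < e := lt_min one_pos (by linarith)
  have he1 : e ≤ 1 := min_le_left _ _
  have heη : 4 * e ≤ η := by linarith [min_le_right 1 (η / 4)]
  set A : ℝ≥0∞ := (∫⁻ x, absE x * decay (1 + s * Q) x) * (∫⁻ x, decay (1 + e * (Q - 1)) x) *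
    ∫⁻ x, decay (2 * b) x with hA
  set B : ℝ≥0∞ := (∫⁻ x, absE x * decay (2 + e) x) * (∫⁻ x, decay (2 * b) x) +
        (2 + 8 * ∫⁻ x, decay (1 + e) x) * ∫⁻ x, decay (2 * b) x with hB
  have hb' : ∫⁻ x, decay (2 * b) x < ∞ := lintegral_decay_lt_top (by linarith)
  have hAt : A < ∞ := ENNReal.mul_lt_top (ENNReal.mul_lt_top
    (lintegral_absE_mul_decay_lt_top (by linarith))
    (lintegral_decay_lt_top (by linarith [mul_pos he0 hQ1]))) hb'
  have hBt : B < ∞ := ENNReal.add_lt_top.2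
    ⟨ENNReal.mul_lt_top (lintegral_absE_mul_decay_lt_top (by linarith)) hb',
      ENNReal.mul_lt_top (ENNReal.add_lt_top.2 ⟨ENNReal.ofNat_lt_top, ENNReal.mul_lt_top
        ENNReal.ofNat_lt_top (lintegral_decay_lt_top (by linarith))⟩) hb'⟩
  refine ⟨A * B ^ (Q - 1), ENNReal.mul_lt_top hAt (ENNReal.rpow_lt_top_of_nonneg hQ1.le hBt.ne),
    fun σ hσ ξ => ?_⟩
  have ht0 : 0 ≤ Q⁻¹ := by positivity
  have ht1 : Q⁻¹ ≤ 1 := inv_le_one_of_one_le₀ hQ.le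
  have hα : (1 + s * Q) * Q⁻¹ + η * (1 - Q⁻¹) = 2 * s := by
    rw [hη]
    field_simp
    ring
  have hβ : (1 + e * (Q - 1)) * Q⁻¹ + (1 - e) * (1 - Q⁻¹) = 1 := by
    field_simp
    ring
  have hpt : ∀ τ, (∫⁻ y, kern (2 * s) 1 (2 * b) σ (ξ, τ) y) ^ Q ≤
      (∫⁻ y, kern (1 + s * Q) (1 + e * (Q - 1)) (2 * b) σ (ξ, τ) y) * B ^ (Q - 1) := fun τ => by
    have h := ENNReal.lintegral_mul_norm_pow_le (μ := volume)
      (measurable_kern_right (1 + s * Q) (1 + e * (Q - 1)) (2 * b) σ (ξ, τ)).aemeasurable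
      (measurable_kern_right η (1 - e) (2 * b) σ (ξ, τ)).aemeasurable
      ht0 (sub_nonneg.2 ht1) (add_sub_cancel _ _)
    simp only [kern_rpow_mul_kern_rpow ht0 ht1, hα, hβ] at h
    refine (ENNReal.rpow_le_rpow h hQ0.le).trans ?_
    rw [ENNReal.mul_rpow_of_nonneg _ _ hQ0.le, ← ENNReal.rpow_mul, ← ENNReal.rpow_mul,
      inv_mul_cancel₀ hQ0.ne', ENNReal.rpow_one,
      show (1 - Q⁻¹) * Q = Q - 1 by field_simp]
    gcongr
    exact lintegral_kern_le he0 he1 heη _ hσ _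
  calc ∫⁻ τ, (∫⁻ y, kern (2 * s) 1 (2 * b) σ (ξ, τ) y) ^ Q
      ≤ ∫⁻ τ, (∫⁻ y, kern (1 + s * Q) (1 + e * (Q - 1)) (2 * b) σ (ξ, τ) y) * B ^ (Q - 1) :=
        lintegral_mono hpt
    _ = A * B ^ (Q - 1) := by
        rw [lintegral_mul_const', lintegral_lintegral_kern]
        exact (ENNReal.rpow_lt_top_of_nonneg hQ1.le hBt.ne).ne

/-! ### Weighted convolutions in mixed norms -/

/-- Cauchy–Schwarz in the convolution variable, then Hölder in `τ` with the exponents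
`2 / (2 - p)` and `2 / p`: a weight in `L^∞_ξ L^{p/(2-p)}_τ` makes the weighted convolution bounded
from `L² × L²` to `L²_ξ L^p_τ`. -/
theorem lintegral_weighted_convolution_le {p : ℝ} (hp : 0 < p) (hp2 : p < 2)
    {w : ℝ × ℝ → ℝ × ℝ → ℝ≥0∞} (hw : Measurable fun q : (ℝ × ℝ) × (ℝ × ℝ) => w q.1 q.2)
    {F G : ℝ × ℝ → ℝ≥0∞} (hF : Measurable F) (hG : Measurable G) {C : ℝ≥0∞}
    (hC : ∀ ξ, ∫⁻ τ, (∫⁻ y, w (ξ, τ) y) ^ (p / (2 - p)) ≤ C) :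
    ∫⁻ ξ, (∫⁻ τ, (∫⁻ y, w (ξ, τ) y ^ (1 / 2 : ℝ) * (F y * G ((ξ, τ) - y))) ^ p) ^ (2 / p) ≤
      C ^ ((2 - p) / p) * ((∫⁻ y, F y ^ (2 : ℝ)) * ∫⁻ y, G y ^ (2 : ℝ)) := by
  have h2p : 0 < 2 - p := by linarith
  set M : ℝ × ℝ → ℝ≥0∞ := fun z => ∫⁻ y, F y ^ (2 : ℝ) * G (z - y) ^ (2 : ℝ) with hM
  have hMm : Measurable M := by
    refine Measurable.lintegral_prod_right' (f := fun q : (ℝ × ℝ) × (ℝ × ℝ) =>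
      F q.2 ^ (2 : ℝ) * G (q.1 - q.2) ^ (2 : ℝ)) ?_
    fun_prop
  have hKm : Measurable fun z => ∫⁻ y, w z y := hw.lintegral_prod_right'
  have hCS : ∀ z : ℝ × ℝ, ∫⁻ y, w z y ^ (1 / 2 : ℝ) * (F y * G (z - y)) ≤
      (∫⁻ y, w z y) ^ (1 / 2 : ℝ) * M z ^ (1 / 2 : ℝ) := fun z => by
    have hwz : Measurable (w z) := hw.comp measurable_prodMk_left
    have h := ENNReal.lintegral_mul_norm_pow_le (μ := volume) hwz.aemeasurable
      (g := fun y => F y ^ (2 : ℝ) * G (z - y) ^ (2 : ℝ)) (by fun_prop)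
      (p := 1 / 2) (q := 1 / 2) (by norm_num) (by norm_num) (by norm_num)
    refine le_of_eq_of_le (lintegral_congr fun y => ?_) h
    rw [← ENNReal.mul_rpow_of_nonneg _ _ zero_le_two, ← ENNReal.rpow_mul]
    norm_num
  have hτ : ∀ ξ, (∫⁻ τ, (∫⁻ y, w (ξ, τ) y ^ (1 / 2 : ℝ) * (F y * G ((ξ, τ) - y))) ^ p) ^ (2 / p) ≤
      C ^ ((2 - p) / p) * ∫⁻ τ, M (ξ, τ) := fun ξ => by
    have h := ENNReal.lintegral_mul_norm_pow_le (μ := volume)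
      (f := fun τ => (∫⁻ y, w (ξ, τ) y) ^ (p / (2 - p))) (g := fun τ => M (ξ, τ))
      ((hKm.comp measurable_prodMk_left).pow_const _).aemeasurable
      (hMm.comp measurable_prodMk_left).aemeasurable
      (p := (2 - p) / 2) (q := p / 2) (by positivity) (by positivity) (by ring)
    have hle : ∫⁻ τ, (∫⁻ y, w (ξ, τ) y ^ (1 / 2 : ℝ) * (F y * G ((ξ, τ) - y))) ^ p ≤
        C ^ ((2 - p) / 2) * (∫⁻ τ, M (ξ, τ)) ^ (p / 2) := by
      refine le_trans (lintegral_mono fun τ => ?_) (h.trans ?_)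
      · refine (ENNReal.rpow_le_rpow (hCS (ξ, τ)) hp.le).trans_eq ?_
        rw [ENNReal.mul_rpow_of_nonneg _ _ hp.le, ← ENNReal.rpow_mul, ← ENNReal.rpow_mul,
          ← ENNReal.rpow_mul]
        congr 2
        · field_simp
        · ring
      · gcongr
        exact hC ξ
    refine (ENNReal.rpow_le_rpow hle (by positivity)).trans_eq ?_
    rw [ENNReal.mul_rpow_of_nonneg _ _ (by positivity), ← ENNReal.rpow_mul, ← ENNReal.rpow_mul,
      show (2 - p) / 2 * (2 / p) = (2 - p) / p by field_simp,
      show p / 2 * (2 / p) = 1 by field_simp, ENNReal.rpow_one]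
  have hMint : ∫⁻ ξ, ∫⁻ τ, M (ξ, τ) = (∫⁻ y, F y ^ (2 : ℝ)) * ∫⁻ y, G y ^ (2 : ℝ) := by
    rw [← lintegral_prod _ hMm.aemeasurable, ← Measure.volume_eq_prod, hM,
      lintegral_lintegral_swap (by fun_prop), ← lintegral_mul_const _ (by fun_prop)]
    refine lintegral_congr fun y => ?_
    rw [lintegral_const_mul _ (by fun_prop)]
    congr 1
    exact lintegral_sub_right_eq_self (fun z => G z ^ (2 : ℝ)) y
  calc _ ≤ ∫⁻ ξ, C ^ ((2 - p) / p) * ∫⁻ τ, M (ξ, τ) := lintegral_mono hτ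
    _ = _ := by rw [lintegral_const_mul _ hMm.lintegral_prod_right', hMint]

/-! ### The weights of the Bourgain norms -/

@[fun_prop]
theorem measurable_hat (u : L2SpaceTime) : Measurable (hat u) := by
  unfold hat
  refine (measurable_const_smul ((2 * Real.pi)⁻¹ : ℝ)).comp
    ((Lp.stronglyMeasurable (FourierTransform.fourier u : L2SpaceTime)).measurable.comp ?_)
  refine (WithLp.measurable_toLp 2 _).comp (measurable_pi_lambda _ fun i => ?_)
  fin_cases i
  · exact measurable_fst.div_const _
  · exact measurable_snd.div_const _

@[fun_prop]
theorem measurable_hatDHalf (u : L2SpaceTime) : Measurable (hatDHalf u) := by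
  unfold hatDHalf
  fun_prop

/-- The integrand of the Bourgain norm `xNorm φ m b u`. -/
noncomputable def weighted (φ : ℝ → ℝ) (m b : ℝ) (u : L2SpaceTime) (y : ℝ × ℝ) : ℝ≥0∞ :=
  ‖(bracket y.1 ^ m * bracket (y.2 + φ y.1) ^ b) • hat u y‖ₑ

theorem measurable_weighted {φ : ℝ → ℝ} (hφ : Measurable φ) (m b : ℝ) (u : L2SpaceTime) :
    Measurable (weighted φ m b u) := by
  unfold weighted
  fun_prop

theorem enorm_hat_eq (φ : ℝ → ℝ) (m b : ℝ) (u : L2SpaceTime) (y : ℝ × ℝ) :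
    ‖hat u y‖ₑ = decay m y.1 * decay b (y.2 + φ y.1) * weighted φ m b u y := by
  have h : ∀ r x : ℝ, decay r x * ENNReal.ofReal (bracket x ^ r) = 1 := fun r x => by
    have := decay_add r (-r) x
    simpa [decay] using this.symm
  rw [weighted, enorm_smul, Real.enorm_of_nonneg (mul_nonneg
    (Real.rpow_nonneg (bracket_pos _).le _) (Real.rpow_nonneg (bracket_pos _).le _)),
    ENNReal.ofReal_mul (Real.rpow_nonneg (bracket_pos _).le _)]
  calc ‖hat u y‖ₑ = decay m y.1 * ENNReal.ofReal (bracket y.1 ^ m) *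
        (decay b (y.2 + φ y.1) * ENNReal.ofReal (bracket (y.2 + φ y.1) ^ b)) * ‖hat u y‖ₑ := by
        rw [h, h, one_mul, one_mul]
    _ = _ := by ring

theorem xNorm_eq (φ : ℝ → ℝ) (m b : ℝ) (u : L2SpaceTime) :
    xNorm φ m b u = (∫⁻ y, weighted φ m b u y ^ (2 : ℝ)) ^ (1 / 2 : ℝ) := by
  rw [xNorm, eLpNorm_eq_lintegral_rpow_enorm_toReal two_ne_zero ENNReal.ofNat_ne_top]
  simp [weighted]

theorem mixedNorm_eq {p : ℝ} (hp : 0 < p) (h : ℝ × ℝ → ℂ) :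
    mixedNorm p h = (∫⁻ ξ, (∫⁻ τ, ‖h (ξ, τ)‖ₑ ^ p) ^ (2 / p)) ^ (1 / 2 : ℝ) := by
  rw [mixedNorm, eLpNorm_eq_lintegral_rpow_enorm_toReal two_ne_zero ENNReal.ofNat_ne_top]
  simp only [enorm_eq_self, ENNReal.toReal_ofNat]
  congr 1
  refine lintegral_congr fun ξ => ?_
  rw [eLpNorm_eq_lintegral_rpow_enorm_toReal (by simpa using hp) ENNReal.ofReal_ne_top,
    ENNReal.toReal_ofReal hp.le, ← ENNReal.rpow_mul]
  congr 1
  ring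

theorem enorm_mul_hat_eq (s b σ : ℝ) (u n : L2SpaceTime) (z y : ℝ × ℝ) :
    ‖ContinuousLinearMap.mul ℂ ℂ (hatDHalf u y) (hat n (z - y))‖ₑ =
      kern (2 * s) 1 (2 * b) σ z y ^ (1 / 2 : ℝ) *
        (weighted schrodingerSymbol s (1 / 2) u y *
          weighted (waveSymbol σ) 0 b n (z - y)) := by
  have hh : (0 : ℝ) ≤ 1 / 2 := by norm_num
  have habs : absE y.1 ^ (1 / 2 : ℝ) = ‖|y.1| ^ (1 / 2 : ℝ)‖ₑ := by
    rw [Real.enorm_of_nonneg (by positivity), absE,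
      ENNReal.ofReal_rpow_of_nonneg (abs_nonneg _) hh]
  have h0 : decay 0 (z - y).1 = 1 := by simp [decay]
  rw [ContinuousLinearMap.mul_apply', enorm_mul, hatDHalf, enorm_smul,
    enorm_hat_eq schrodingerSymbol s (1 / 2) u y, enorm_hat_eq (waveSymbol σ) 0 b n (z - y), kern,
    ENNReal.mul_rpow_of_nonneg _ _ hh, ENNReal.mul_rpow_of_nonneg _ _ hh,
    ENNReal.mul_rpow_of_nonneg _ _ hh, decay_rpow, decay_rpow, decay_rpow, habs, h0,
    schrodingerSymbol, waveSymbol, sq_abs, Prod.fst_sub, Prod.snd_sub,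
    show 2 * s * (1 / 2) = s by ring, show 2 * b * (1 / 2) = b by ring, one_mul]
  ring_nf

end Zakharov

open Zakharov in
theorem lemma2p4 :
    ∀ s : ℝ, 0 < s →
      ∃ p₀ : ℝ, p₀ < 2 ∧
        ∀ p : ℝ, p₀ < p → p < 2 →
          ∀ b : ℝ, 1 / 2 < b →
            ∃ c : NNReal,
              ∀ σ : ℝ, σ = 1 ∨ σ = -1 →
                ∀ u n : Zakharov.L2SpaceTime,
                  Zakharov.MemX Zakharov.schrodingerSymbol s (1 / 2) u →
                  Zakharov.MemX (Zakharov.waveSymbol σ) 0 b n →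
                    (∀ᵐ z : ℝ × ℝ,
                      ConvolutionExistsAt (Zakharov.hatDHalf u) (Zakharov.hat n) z
                        (ContinuousLinearMap.mul ℂ ℂ) volume) ∧
                    Zakharov.mixedNorm p
                        (convolution (Zakharov.hatDHalf u) (Zakharov.hat n)
                          (ContinuousLinearMap.mul ℂ ℂ) volume) ≤
                      c * Zakharov.xNorm (Zakharov.waveSymbol σ) 0 b n *
                        Zakharov.xNorm Zakharov.schrodingerSymbol s (1 / 2) u := by
  intro s hs
  -- `p > p₀` says exactly that `Q = p / (2 - p)` satisfies `Q > 1` and `s * Q > 1`.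
  refine ⟨max 1 (2 / (1 + s)), max_lt one_lt_two
    ((div_lt_iff₀ (by linarith)).2 (by linarith)), fun p hp₀ hp2 b hb => ?_⟩
  obtain ⟨hp1, hps⟩ := max_lt_iff.1 hp₀
  have hp : 0 < p := by linarith
  have h2p : 0 < 2 - p := by linarith
  rw [div_lt_iff₀ (by linarith)] at hps
  obtain ⟨C, hCt, hC⟩ := exists_lintegral_kern_rpow_le (s := s) (b := b) (Q := p / (2 - p))
    ((one_lt_div h2p).2 (by linarith))
    (by rw [← mul_div_assoc, one_lt_div h2p]; linarith) hb
  have hc : (C ^ ((2 - p) / p)) ^ (1 / 2 : ℝ) ≠ ⊤ :=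
    ENNReal.rpow_ne_top_of_nonneg (by norm_num)
      (ENNReal.rpow_ne_top_of_nonneg (by positivity) hCt.ne)
  refine ⟨((C ^ ((2 - p) / p)) ^ (1 / 2 : ℝ)).toNNReal, fun σ hσ u n hu hn => ?_⟩
  rw [ENNReal.coe_toNNReal hc]
  set F := weighted schrodingerSymbol s (1 / 2) u with hF
  set G := weighted (waveSymbol σ) 0 b n with hG
  have hFm : Measurable F := measurable_weighted (by unfold schrodingerSymbol; fun_prop) _ _ _
  have hGm : Measurable G := measurable_weighted (by unfold waveSymbol; fun_prop) _ _ _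
  have hF2 : ∫⁻ y, F y ^ (2 : ℝ) < ⊤ := by
    rw [MemX, xNorm_eq] at hu
    exact (ENNReal.rpow_lt_top_iff_of_pos (by norm_num)).1 hu
  have hG2 : ∫⁻ y, G y ^ (2 : ℝ) < ⊤ := by
    rw [MemX, xNorm_eq] at hn
    exact (ENNReal.rpow_lt_top_iff_of_pos (by norm_num)).1 hn
  set H : ℝ × ℝ → ENNReal := fun z =>
    ∫⁻ y, ‖ContinuousLinearMap.mul ℂ ℂ (hatDHalf u y) (hat n (z - y))‖ₑ with hH
  have hHm : Measurable H := by
    refine Measurable.lintegral_prod_right' (f := fun q : (ℝ × ℝ) × (ℝ × ℝ) =>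
      ‖ContinuousLinearMap.mul ℂ ℂ (hatDHalf u q.2) (hat n (q.1 - q.2))‖ₑ) ?_
    simp only [ContinuousLinearMap.mul_apply']
    fun_prop
  have hHle : ∫⁻ ξ, (∫⁻ τ, H (ξ, τ) ^ p) ^ (2 / p) ≤
      C ^ ((2 - p) / p) * ((∫⁻ y, F y ^ (2 : ℝ)) * ∫⁻ y, G y ^ (2 : ℝ)) := by
    simp only [hH, enorm_mul_hat_eq s b σ u n]
    exact lintegral_weighted_convolution_le hp hp2 (measurable_kern _ _ _ _) hFm hGm (hC σ hσ)
  constructor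
  · have hfin : ∀ᵐ ξ : ℝ, ∀ᵐ τ : ℝ, H (ξ, τ) < ⊤ := by
      have hHp : Measurable fun z => H z ^ p := hHm.pow_const p
      have h1 := ae_lt_top (hHp.lintegral_prod_right'.pow_const (2 / p)) (hHle.trans_lt
        (ENNReal.mul_lt_top (ENNReal.rpow_lt_top_of_nonneg (by positivity) hCt.ne)
          (ENNReal.mul_lt_top hF2 hG2))).ne
      filter_upwards [h1] with ξ hξ
      have h2 := ae_lt_top (hHp.comp (measurable_prodMk_left (x := ξ)))
        ((ENNReal.rpow_lt_top_iff_of_pos (by positivity)).1 hξ).ne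
      filter_upwards [h2] with τ hτ
      exact (ENNReal.rpow_lt_top_iff_of_pos hp).1 hτ
    have hae : ∀ᵐ z : ℝ × ℝ, H z < ⊤ := by
      rw [Measure.volume_eq_prod]
      exact (Measure.ae_prod_iff_ae_ae (measurableSet_lt hHm measurable_const)).2 hfin
    filter_upwards [hae] with z hz
    refine ⟨Measurable.aestronglyMeasurable ?_, hz⟩
    simp only [ContinuousLinearMap.mul_apply']
    fun_prop
  · rw [mixedNorm_eq hp, xNorm_eq, xNorm_eq, mul_assoc,
      ← ENNReal.mul_rpow_of_nonneg _ _ (by norm_num),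
      ← ENNReal.mul_rpow_of_nonneg _ _ (by norm_num),
      mul_comm (∫⁻ y, G y ^ (2 : ℝ))]
    refine ENNReal.rpow_le_rpow (le_trans (lintegral_mono fun ξ => ?_) hHle) (by norm_num)
    refine ENNReal.rpow_le_rpow (lintegral_mono fun τ => ?_) (by positivity)
    exact ENNReal.rpow_le_rpow (enorm_integral_le_lintegral_enorm _) hp.le
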